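/- Let $I=(a,b)$, $a<b$, be a bounded interval. $J$ denotes subintervals of $I$ of positive length $|J|$ ($J=I$ allowed), and $\langle\cdot\rangle_J$ the average over $J$ with respect to Lebesgue measure. A modulus on $[0,|I|]$ is a continuous (weakly) increasing function $\xi\colon[0,|I|]\to[0,\infty)$ with $\xi(0)=0$. For such $\xi$ let $\Xi_\xi(I)$ be the class of all $\varphi\in L^2(I)$ (real-valued) for which $$\|\varphi\|_{\Xi_\xi(I)}:=\inf\big\{C>0\colon \langle\varphi^2\rangle_J-\langle\varphi\rangle_J^2\le C^2\xi^2(|J|)\ \text{ for all } J\subset I\big\}$$ is finite, i.e. for which some such $C$ exists. The decreasing rearrangement of a measurable $\varphi\colon I\to\mathbb R$ is $$\varphi^*(t)=\inf\big\{\lambda\in\mathbb{R}\colon |\{s\in I\colon \varphi(s)>\lambda\}|\le t-a\big\},\qquad t\in I.$$ **Theorem 1.2.** Let $\xi$ be a modulus on $[0,|I|]$. If $\varphi\in\Xi_\xi(I)$, then $\varphi^*\in\Xi_\xi(I)$ and $$\|\varphi^*\|_{\Xi_\xi(I)}\le\|\varphi\|_{\Xi_\xi(I)}.$$ Equivalently,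 in terms of associated moduli: let $\mathrm{VMO}(I)$ be the set of all $\varphi\in L^2(I)$ such that $\langle\varphi^2\rangle_J-\langle\varphi\rangle_J^2\to0$ as $|J|\to0$, uniformly in $J\subset I$, and put $\xi_\varphi(0)=0$ and $$\xi_\varphi(t)=\sup\big\{(\langle\varphi^2\rangle_J-\langle\varphi\rangle_J^2)^{1/2}\colon J\subset I,\ 0<|J|\le t\big\},\qquad 0<t\le|I|.$$ If $\varphi\in\mathrm{VMO}(I)$, then $\varphi^*\in\mathrm{VMO}(I)$ and $\xi_{\varphi^*}(t)\le\xi_\varphi(t)$ for all $t\in[0,|I|]$. -/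

import Mathlib

open MeasureTheory

namespace Campanato

/-- `ξ` is a modulus on `[0, T]`: continuous, (weakly) increasing, `ξ 0 = 0`
(hence nonnegative on `[0, T]`). Only the values on `[0, T]` matter. -/
structure IsModulus (T : ℝ) (ξ : ℝ → ℝ) : Prop where
  continuousOn : ContinuousOn ξ (Set.Icc 0 T)
  monotoneOn : MonotoneOn ξ (Set.Icc 0 T)
  map_zero : ξ 0 = 0

/-- `⟨φ²⟩_J - ⟨φ⟩_J²` for the interval `J = (c, d)`, averages being taken with respect to
Lebesgue measure. -/
noncomputable def osc (φ : ℝ → ℝ) (c d : ℝ) : ℝ :=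
  (⨍ x in Set.Ioo c d, φ x ^ 2) - (⨍ x in Set.Ioo c d, φ x) ^ 2

/-- The numbers `C > 0` with `⟨φ²⟩_J - ⟨φ⟩_J² ≤ C² ξ²(|J|)` for every subinterval
`J` of `I = (a, b)` of positive length. Endpoints of `J` do not influence the averages, so
that `J` runs through the open intervals `(c, d)` with `a ≤ c < d ≤ b`. -/
def bounds (a b : ℝ) (ξ φ : ℝ → ℝ) : Set ℝ :=
  {C | 0 < C ∧ ∀ c d : ℝ, a ≤ c → c < d → d ≤ b → osc φ c d ≤ C ^ 2 * ξ (d - c) ^ 2}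

/-- The class `Ξ_ξ(I)`, `I = (a, b)`. The averages of `φ` and `φ²` over all subintervals
(in particular over `I` itself) have to make sense, that is, `φ ∈ L²(I)`. Only the values of `φ`
on `I` matter. -/
structure MemClass (a b : ℝ) (ξ φ : ℝ → ℝ) : Prop where
  memLp : MemLp φ 2 (volume.restrict (Set.Ioo a b))
  nonempty_bounds : (bounds a b ξ φ).Nonempty

/-- The seminorm of `φ` in `Ξ_ξ(I)`, `I = (a, b)`. -/
noncomputable def classNorm (a b : ℝ) (ξ φ : ℝ → ℝ) : ℝ :=
  sInf (bounds a b ξ φ)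

/-- The decreasing rearrangement of `f` on `I = (a, b)`:
`f*(t) = inf {λ : |{s ∈ I : f s > λ}| ≤ t - a}` for `t ∈ I`. (For measurable real-valued `f`
and `t ∈ I` the set of such `λ` is nonempty and bounded below; values of `f*` off `I` are
never used.) -/
noncomputable def rearr (a b : ℝ) (f : ℝ → ℝ) (t : ℝ) : ℝ :=
  sInf {l : ℝ | volume {s | s ∈ Set.Ioo a b ∧ l < f s} ≤ ENNReal.ofReal (t - a)}

/-- `VMO(I)`, `I = (a, b)`, described by quadratic oscillations:
`⟨φ²⟩_J - ⟨φ⟩_J² → 0` as `|J| → 0`, uniformly in `J ⊆ I`. -/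
structure MemVMO (a b : ℝ) (φ : ℝ → ℝ) : Prop where
  memLp : MemLp φ 2 (volume.restrict (Set.Ioo a b))
  vanishing : ∀ ε > 0, ∃ δ > 0, ∀ c d : ℝ, a ≤ c → c < d → d ≤ b → d - c ≤ δ → osc φ c d ≤ ε

/-- The modulus `ξ_φ` associated with `φ` on `I = (a, b)`:
`ξ_φ(t) = sup {(⟨φ²⟩_J - ⟨φ⟩_J²)^{1/2} : J ⊆ I, 0 < |J| ≤ t}` for `t > 0`, and `ξ_φ(0) = 0`. -/
noncomputable def assocModulus (a b : ℝ) (φ : ℝ → ℝ) (t : ℝ) : ℝ :=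
  if t = 0 then 0
  else sSup {y | ∃ c d : ℝ, a ≤ c ∧ c < d ∧ d ≤ b ∧ d - c ≤ t ∧ y = Real.sqrt (osc φ c d)}

end Campanato

namespace Campanato
open Set Filter Topology

/-! Everything reduces to one estimate (`osc_rearr_le`): if `φ` has oscillation at most `M` on every
interval of length at most `L`, then `ψ = φ*` has oscillation at most `M` on each interval `J` of
length `L`. Monotonicity of the modulus and comparison of infima or suprema do the rest.

Let `J = (c, d)` lie strictly inside `I`, with `w = ψ c`, `m = ψ d`, `α` the mean of `ψ` on `J`, `r
= w - α`, `s = α - m`, and let `g` be `φ` truncated to `[m, w]`, minus `α`. Then `L * osc ψ c d = r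
s L - ∫_J (ψ - m)(w - ψ)`, and by equimeasurability the last integral equals `∫_I (g + s)(r - g)`,
since the truncated integrand vanishes off `J`. It remains to show `(r s - M) L ≤ ∫_I (g + s)(r -
g)` when `M < r s` (`le_integral_mul_of_chords`).

A horizontal chord of the primitive `F` of `g` is an interval on which `g` has mean zero; if its
length is at most `L`, the mean square of `g` there is at most `M`, because truncation does not
increase variance. Disjoint unions of such chords (`Balanced` sets) contribute at least `r s - M`
per unit length, so total length `L` suffices. A chord of length at least `L` yields this by a chord
argument. Otherwise every chord is short, and the rising sun lemma gives a balanced set off which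
`g` has one sign; there a linear lower bound for the integrand makes up the missing length. -/

/-! ### Horizontal chords of continuous functions and the rising sun lemma. -/

theorem exists_two_short_chords {F : ℝ → ℝ} {u v L : ℝ} (hL : 0 < L) (huv : u + L ≤ v)
    (hF : ContinuousOn F (Icc u v)) (h : F u = F v)
    (hlt : ∀ x ∈ Icc u (v - L), F x < F (x + L)) :
    ∃ z w, u < z ∧ z < w ∧ w ≤ v ∧ z - u ≤ L ∧ w - z ≤ L ∧ u + L ≤ w ∧ F z = F u ∧ F w = F u := by
  -- the first return to the level `F u` after `u + L`
  have hcl : IsCompact (Icc (u + L) v ∩ F ⁻¹' {F u}) := by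
    apply IsCompact.of_isClosed_subset (isCompact_Icc (a := u + L) (b := v)) _ inter_subset_left
    exact (hF.mono (Icc_subset_Icc_left (by linarith))).preimage_isClosed_of_isClosed
      isClosed_Icc isClosed_singleton
  obtain ⟨w, ⟨⟨hw1, hw2⟩, hFw⟩, hmin⟩ :=
    hcl.exists_isLeast ⟨v, ⟨huv, le_rfl⟩, h.symm⟩
  have hFw : F w = F u := hFw
  have hu : F u < F (u + L) := hlt u ⟨le_rfl, by linarith⟩
  have hw : F (w - L) < F w := by
    simpa using hlt (w - L) ⟨by linarith, by linarith⟩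
  -- Otherwise `F` descends from above the level at `u + L` to below it at `w - L`, so it returns
  -- before `w`.
  have hlow : w - L < u + L := by
    by_contra! hcon
    obtain ⟨z, ⟨hz1, hz2⟩, hz⟩ : F u ∈ F '' Icc (u + L) (w - L) :=
      intermediate_value_Icc' hcon (hF.mono (Icc_subset_Icc (by linarith) (by linarith)))
        ⟨by linarith, hu.le⟩
    have := hmin ⟨⟨hz1, by linarith⟩, hz⟩
    linarith
  obtain ⟨z, ⟨hz1, hz2⟩, hz⟩ : F u ∈ F '' Ioo (w - L) (u + L) :=
    intermediate_value_Ioo hlow.le (hF.mono (Icc_subset_Icc (by linarith) (by linarith)))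
      ⟨by linarith, hu⟩
  exact ⟨z, w, by linarith, by linarith, hw2, by linarith, by linarith, hw1, hz, hFw⟩

/-- The increment `F (x + L) - F x` either vanishes somewhere or has constant sign; the negative
sign reduces to the positive one through `-F`. In the second alternative the two adjacent chords
together have length at least `L`. -/
theorem exists_chord_or_two_short_chords {F : ℝ → ℝ} {u v L : ℝ} (hL : 0 < L) (huv : u + L ≤ v)
    (hF : ContinuousOn F (Icc u v)) (h : F u = F v) :
    (∃ x, u ≤ x ∧ x + L ≤ v ∧ F x = F (x + L)) ∨
    ∃ z w, u < z ∧ z < w ∧ w ≤ v ∧ z - u ≤ L ∧ w - z ≤ L ∧ u + L ≤ w ∧ F z = F u ∧ F w = F u := by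
  by_cases hex : ∃ x ∈ Icc u (v - L), F x = F (x + L)
  · obtain ⟨x, ⟨h1, h2⟩, h3⟩ := hex
    exact .inl ⟨x, h1, by linarith, h3⟩
  right
  push Not at hex
  have hD : ContinuousOn (fun x => F (x + L) - F x) (Icc u (v - L)) := by
    refine ContinuousOn.sub (hF.comp (by fun_prop) ?_) (hF.mono (Icc_subset_Icc_right (by linarith)))
    intro x hx
    exact ⟨by linarith [hx.1], by linarith [hx.2]⟩
  by_cases hall : ∀ x ∈ Icc u (v - L), F x < F (x + L)
  · exact exists_two_short_chords hL huv hF h hall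
  by_cases hall' : ∀ x ∈ Icc u (v - L), F (x + L) < F x
  · obtain ⟨z, w, h1, h2, h3, h4, h5, h6, h7, h8⟩ :=
      exists_two_short_chords (F := fun x => -F x) hL huv hF.neg (by simpa using h)
        (fun x hx => by simpa using hall' x hx)
    exact ⟨z, w, h1, h2, h3, h4, h5, h6, by simpa using h7, by simpa using h8⟩
  push Not at hall hall'
  obtain ⟨x, hx, hx'⟩ := hall
  obtain ⟨y, hy, hy'⟩ := hall'
  obtain ⟨z, hz, hz'⟩ := isPreconnected_Icc.intermediate_value hx hy hD
    (show (0 : ℝ) ∈ Icc _ _ from ⟨by linarith, by linarith⟩)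
  exact absurd (by simpa [sub_eq_zero] using hz') (fun hh => hex z hz (Eq.symm hh))

/-- The rising sun lemma for a continuous function whose maximum is attained at the left end. -/
theorem exists_rising_sun {F : ℝ → ℝ} {e b : ℝ} (hF : ContinuousOn F (Icc e b))
    (hFe : ∀ x ∈ Icc e b, F x ≤ F e) :
    ∃ S : Set (ℝ × ℝ), S.Countable ∧ S.PairwiseDisjoint (fun p => Ioo p.1 p.2) ∧
      (∀ p ∈ S, e ≤ p.1 ∧ p.1 < p.2 ∧ p.2 ≤ b ∧ F p.1 = F p.2) ∧
      ∀ x ∈ Ioo e b, x ∉ ⋃ p ∈ S, Ioo p.1 p.2 → ∀ y ∈ Icc x b, F y ≤ F x := by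
  set W : Set ℝ := {x | x ∈ Ioo e b ∧ ∃ y ∈ Ioc x b, F x < F y} with hW
  have hWo : IsOpen W := by
    rw [isOpen_iff_mem_nhds]
    rintro x ⟨hx, y, hy, hxy⟩
    have hc : ContinuousAt F x := hF.continuousAt (Icc_mem_nhds hx.1 hx.2)
    filter_upwards [isOpen_Ioo.mem_nhds hx, hc.eventually (gt_mem_nhds hxy), gt_mem_nhds hy.1]
      with z h1 h2 h3
    exact ⟨h1, y, ⟨h3, hy.2⟩, h2⟩
  -- The connected components of the open set `W`, encoded by their endpoints.
  set S : Set (ℝ × ℝ) := {p | e ≤ p.1 ∧ p.1 < p.2 ∧ p.2 ≤ b ∧ p.1 ∉ W ∧ p.2 ∉ W ∧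
    Ioo p.1 p.2 ⊆ W} with hS
  have hdisj : S.PairwiseDisjoint (fun p => Ioo p.1 p.2) := by
    rintro ⟨p1, p2⟩ ⟨_, hp, _, hp1, hp2, hpW⟩ ⟨q1, q2⟩ ⟨_, hq, _, hq1, hq2, hqW⟩ hne
    rw [Function.onFun, Set.disjoint_left]
    rintro x ⟨hx1, hx2⟩ ⟨hy1, hy2⟩
    simp only at *
    apply hne
    have e1 : p1 = q1 := by
      rcases lt_trichotomy p1 q1 with h | h | h
      · exact absurd (hpW ⟨h, by linarith⟩) hq1
      · exact h
      · exact absurd (hqW ⟨h, by linarith⟩) hp1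
    have e2 : p2 = q2 := by
      rcases lt_trichotomy p2 q2 with h | h | h
      · exact absurd (hqW ⟨by linarith, h⟩) hp2
      · exact h
      · exact absurd (hpW ⟨by linarith, h⟩) hq2
    rw [e1, e2]
  have hcount : S.Countable :=
    hdisj.countable_of_isOpen (fun _ _ => isOpen_Ioo) (fun p hp => nonempty_Ioo.2 hp.2.1)
  refine ⟨S, hcount, hdisj, ?_, ?_⟩
  · rintro ⟨u, v⟩ ⟨heu, huv, hvb, huW, hvW, hsub⟩
    simp only at *
    refine ⟨heu, huv, hvb, le_antisymm ?_ ?_⟩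
    -- A maximizer of `F` on `[x, b]` is not in `W`, so it lies at or beyond `v`; as `v` is not in
    -- `W` either, its value is at most `F v`.
    · have key : ∀ x ∈ Ioo u v, F x ≤ F v := by
        intro x hx
        obtain ⟨y, hy, hmax⟩ := (isCompact_Icc (a := x) (b := b)).exists_isMaxOn
          ⟨x, le_rfl, by linarith [hx.2]⟩ (hF.mono (Icc_subset_Icc_left (by linarith [hx.1])))
        have hymax : ∀ z ∈ Icc x b, F z ≤ F y := fun z hz => hmax hz
        have hvy : v ≤ y := by
          by_contra! hlt
          obtain ⟨_, z, hz, hyz⟩ := hsub ⟨lt_of_lt_of_le hx.1 hy.1, hlt⟩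
          exact absurd (hymax z ⟨by linarith [hy.1, hz.1], hz.2⟩) (not_le.2 hyz)
        have hyv : F y ≤ F v := by
          rcases hvy.eq_or_lt with h | h
          · rw [h]
          · by_contra! hlt
            exact hvW ⟨⟨by linarith, lt_of_lt_of_le h hy.2⟩, y, ⟨h, hy.2⟩, hlt⟩
        exact (hymax x ⟨le_rfl, by linarith [hx.2]⟩).trans hyv
      have hcu : ContinuousWithinAt F (Ioo u v) u :=
        (hF u ⟨heu, by linarith⟩).mono (fun z hz => ⟨by linarith [hz.1], by linarith [hz.2]⟩)
      have : (𝓝[Ioo u v] u).NeBot := by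
        rw [← mem_closure_iff_nhdsWithin_neBot, closure_Ioo huv.ne]
        exact ⟨le_rfl, huv.le⟩
      exact le_of_tendsto hcu (eventually_nhdsWithin_of_forall key)
    · rcases heu.eq_or_lt with h | h
      · rw [← h]; exact hFe v ⟨by linarith, hvb⟩
      · by_contra! hlt
        exact huW ⟨⟨h, by linarith⟩, v, ⟨huv, hvb⟩, hlt⟩
  · intro x hx hxS y hy
    by_contra! hlt
    have hxW : x ∈ W := by
      refine ⟨hx, y, ⟨lt_of_le_of_ne hy.1 ?_, hy.2⟩, hlt⟩
      rintro rfl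
      exact lt_irrefl _ hlt
    apply hxS
    have heW : e ∉ W := fun h => lt_irrefl _ h.1.1
    have hbW : b ∉ W := fun h => lt_irrefl _ h.1.2
    obtain ⟨u, ⟨hu, huW⟩, hug⟩ := ((isCompact_Icc (a := e) (b := x)).inter_right
      hWo.isClosed_compl).exists_isGreatest ⟨e, ⟨le_rfl, hx.1.le⟩, heW⟩
    obtain ⟨v, ⟨hv, hvW⟩, hvl⟩ := ((isCompact_Icc (a := x) (b := b)).inter_right
      hWo.isClosed_compl).exists_isLeast ⟨b, ⟨hx.2.le, le_rfl⟩, hbW⟩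
    have hux : u < x := lt_of_le_of_ne hu.2 (by rintro rfl; exact huW hxW)
    have hxv : x < v := lt_of_le_of_ne hv.1 (by rintro rfl; exact hvW hxW)
    refine mem_iUnion₂.2 ⟨(u, v), ⟨hu.1, by simpa using hux.trans hxv, hv.2, huW, hvW, ?_⟩,
      ⟨hux, hxv⟩⟩
    rintro z ⟨hz1, hz2⟩
    simp only at hz1 hz2
    by_contra hzW
    rcases le_total z x with h | h
    · exact absurd (hug ⟨⟨by linarith [hu.1], h⟩, hzW⟩) (not_le.2 hz1)
    · exact absurd (hvl ⟨⟨h, by linarith [hv.2]⟩, hzW⟩) (not_le.2 hz2)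

/-! ### Balanced sets. -/

/-- `U` carries zero mean of `g` and mean square of `g` at most `M`. -/
structure Balanced (g : ℝ → ℝ) (M : ℝ) (U : Set ℝ) : Prop where
  measurableSet : MeasurableSet U
  integral_eq : ∫ x in U, g x = 0
  integral_sq_le : ∫ x in U, (g x ^ 2 - M) ≤ 0

theorem Balanced.empty (g : ℝ → ℝ) (M : ℝ) : Balanced g M ∅ := ⟨.empty, by simp, by simp⟩

theorem Balanced.union {g : ℝ → ℝ} {M : ℝ} {U V : Set ℝ} (hU : Balanced g M U)
    (hV : Balanced g M V) (hUV : Disjoint U V) (hg : IntegrableOn g (U ∪ V))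
    (hg2 : IntegrableOn (fun x => g x ^ 2 - M) (U ∪ V)) : Balanced g M (U ∪ V) := by
  refine ⟨hU.1.union hV.1, ?_, ?_⟩
  · rw [setIntegral_union hUV hV.1 hg.left_of_union hg.right_of_union, hU.2, hV.2, add_zero]
  · rw [setIntegral_union hUV hV.1 hg2.left_of_union hg2.right_of_union]
    linarith [hU.3, hV.3]

theorem Balanced.biUnion {g : ℝ → ℝ} {M : ℝ} {ι : Type*} {S : Set ι} {U : ι → Set ℝ}
    (hS : S.Countable) (hd : S.PairwiseDisjoint U) (hU : ∀ p ∈ S, Balanced g M (U p))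
    (hg : IntegrableOn g (⋃ p ∈ S, U p))
    (hg2 : IntegrableOn (fun x => g x ^ 2 - M) (⋃ p ∈ S, U p)) :
    Balanced g M (⋃ p ∈ S, U p) := by
  have := hS.to_subtype
  rw [biUnion_eq_iUnion] at hg hg2 ⊢
  have hm : ∀ p : S, MeasurableSet (U p) := fun p => (hU p p.2).1
  have hd' : Pairwise (Function.onFun Disjoint fun p : S => U p) := hd.subtype _ _
  refine ⟨.iUnion hm, ?_, ?_⟩
  · rw [integral_iUnion hm hd' hg]
    simp [fun p : S => (hU p p.2).2]
  · rw [integral_iUnion hm hd' hg2]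
    exact tsum_nonpos fun p => (hU p p.2).3

/-! ### The lower bound for `∫ (g + s)(r - g)`. -/

section Bounded

variable {a b r s M L : ℝ} {g : ℝ → ℝ}

theorem integrableOn_of_bounds (hgm : AEStronglyMeasurable g (volume.restrict (Ioo a b)))
    (hs : ∀ x, -s ≤ g x) (hr : ∀ x, g x ≤ r) : IntegrableOn g (Ioo a b) := by
  refine Integrable.of_bound hgm (max r s) (ae_of_all _ fun x => ?_)
  rw [Real.norm_eq_abs, abs_le]
  exact ⟨by linarith [le_max_right r s, hs x], (hr x).trans (le_max_left _ _)⟩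

theorem integrableOn_sq_of_bounds (hgm : AEStronglyMeasurable g (volume.restrict (Ioo a b)))
    (hs : ∀ x, -s ≤ g x) (hr : ∀ x, g x ≤ r) : IntegrableOn (fun x => g x ^ 2) (Ioo a b) := by
  refine Integrable.of_bound (hgm.pow 2) (max r s ^ 2) (ae_of_all _ fun x => ?_)
  rw [Real.norm_eq_abs, abs_pow]
  refine pow_le_pow_left₀ (abs_nonneg _) (abs_le.2 ?_) 2
  exact ⟨by linarith [le_max_right r s, hs x], (hr x).trans (le_max_left _ _)⟩

/-- In `(g + s)(r - g) = r s + (r - s) g - g²` the linear term integrates to zero over a balanced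
set. -/
theorem Balanced.le_setIntegral {U : Set ℝ} (hU : Balanced g M U) (hUm : volume U ≠ ⊤)
    (hg : IntegrableOn g U) (hg2 : IntegrableOn (fun x => g x ^ 2) U) :
    (r * s - M) * volume.real U ≤ ∫ x in U, (g x + s) * (r - g x) := by
  have hc : ∀ k : ℝ, IntegrableOn (fun _ => k) U := fun k => integrableOn_const hUm
  have e : ∀ x, (g x + s) * (r - g x) = ((r * s - M) + (r - s) * g x) - (g x ^ 2 - M) := by
    intro x; ring
  simp_rw [e]
  rw [integral_sub (f := fun x => (r * s - M) + (r - s) * g x) (g := fun x => g x ^ 2 - M)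
    ((hc _).add (hg.const_mul _)) (Integrable.sub hg2 (hc M)), integral_add (hc _) (hg.const_mul _),
    integral_const_mul, hU.2, setIntegral_const]
  simp only [smul_eq_mul]
  linarith [hU.3]

theorem le_integral_of_balanced (hgm : AEStronglyMeasurable g (volume.restrict (Ioo a b)))
    (hs : ∀ x, -s ≤ g x) (hr : ∀ x, g x ≤ r) (hM : M ≤ r * s) {U : Set ℝ} (hU : Balanced g M U)
    (hUI : U ⊆ Ioo a b) (hL : L ≤ volume.real U) :
    (r * s - M) * L ≤ ∫ x in Ioo a b, (g x + s) * (r - g x) := by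
  have hg := integrableOn_of_bounds hgm hs hr
  have hg2 := integrableOn_sq_of_bounds hgm hs hr
  have hc : ∀ k : ℝ, IntegrableOn (fun _ => k) (Ioo a b) := fun k => integrableOn_const (by simp)
  have hUm : volume U ≠ ⊤ := ((measure_mono hUI).trans_lt (by simp)).ne
  calc (r * s - M) * L ≤ (r * s - M) * volume.real U :=
        mul_le_mul_of_nonneg_left hL (by linarith)
    _ ≤ ∫ x in U, (g x + s) * (r - g x) :=
        hU.le_setIntegral hUm (hg.mono_set hUI) (hg2.mono_set hUI)
    _ ≤ _ := by
        refine setIntegral_mono_set ?_ (ae_of_all _ fun x =>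
          mul_nonneg (by linarith [hs x]) (by linarith [hr x])) hUI.eventuallyLE
        have : (fun x => (g x + s) * (r - g x)) =
            fun x => (r * s + (r - s) * g x) - g x ^ 2 := by ext x; ring
        rw [this]
        exact ((hc _).add (hg.const_mul _)).sub hg2

theorem HasDerivAt.nonpos_of_forall_right {F : ℝ → ℝ} {F' x b : ℝ} (h : HasDerivAt F F' x)
    (hxb : x < b) (hF : ∀ y ∈ Icc x b, F y ≤ F x) : F' ≤ 0 := by
  have h1 : Tendsto (slope F x) (𝓝[>] x) (𝓝 F') :=
    (hasDerivWithinAt_iff_tendsto_slope' (by simp)).1 (h.hasDerivWithinAt (s := Ioi x))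
  refine le_of_tendsto h1 ?_
  filter_upwards [Ioo_mem_nhdsGT hxb] with y hy
  rw [slope_def_field]
  exact div_nonpos_of_nonpos_of_nonneg (by linarith [hF y ⟨hy.1.le, hy.2.le⟩]) (by linarith [hy.1])

theorem integral_Ioo_eq_sub (hab : a < b) (hg : IntegrableOn g (Ioo a b)) {x y : ℝ} (hx : a ≤ x)
    (hxy : x ≤ y) (hy : y ≤ b) :
    ∫ t in Ioo x y, g t = (∫ t in a..y, g t) - ∫ t in a..x, g t := by
  have hi : IntervalIntegrable g volume a b :=
    (intervalIntegrable_iff_integrableOn_Ioo_of_le hab.le).2 hg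
  have h1 : IntervalIntegrable g volume a x :=
    hi.mono_set (by rw [uIcc_of_le hx, uIcc_of_le hab.le]; exact Icc_subset_Icc_right (by linarith))
  have h2 : IntervalIntegrable g volume a y :=
    hi.mono_set (by
      rw [uIcc_of_le (hx.trans hxy), uIcc_of_le hab.le]; exact Icc_subset_Icc_right (by linarith))
  rw [intervalIntegral.integral_interval_sub_left h2 h1, intervalIntegral.integral_of_le hxy,
    integral_Ioc_eq_integral_Ioo]

theorem continuousOn_primitive_Icc (hab : a < b) (hg : IntegrableOn g (Ioo a b)) :
    ContinuousOn (fun x => ∫ t in a..x, g t) (Icc a b) := by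
  have h := intervalIntegral.continuousOn_primitive_interval (f := g) (μ := volume) (a := a)
    (b := b) (by rw [uIcc_of_le hab.le]; rwa [integrableOn_Icc_iff_integrableOn_Ioo])
  rwa [uIcc_of_le hab.le] at h

theorem le_integral_of_long_chord (hab : a < b) (hL : 0 < L)
    (hgm : AEStronglyMeasurable g (volume.restrict (Ioo a b)))
    (hs : ∀ x, -s ≤ g x) (hr : ∀ x, g x ≤ r) (hM : M ≤ r * s)
    (hchord : ∀ x y, a ≤ x → x < y → y ≤ b → y - x ≤ L → ∫ t in Ioo x y, g t = 0 →
      ∫ t in Ioo x y, (g t ^ 2 - M) ≤ 0) {u v : ℝ} (hau : a ≤ u) (hvb : v ≤ b) (huv : u + L ≤ v)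
    (h : ∫ t in a..u, g t = ∫ t in a..v, g t) :
    (r * s - M) * L ≤ ∫ x in Ioo a b, (g x + s) * (r - g x) := by
  have hg := integrableOn_of_bounds hgm hs hr
  have hg2 : IntegrableOn (fun x => g x ^ 2 - M) (Ioo a b) :=
    (integrableOn_sq_of_bounds hgm hs hr).sub (integrableOn_const (by simp))
  have hbal : ∀ x y, a ≤ x → x < y → y ≤ b → y - x ≤ L →
      ∫ t in a..x, g t = ∫ t in a..y, g t → Balanced g M (Ioo x y) := by
    intro x y hx hxy hy hlen he
    have h0 : ∫ t in Ioo x y, g t = 0 := by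
      rw [integral_Ioo_eq_sub hab hg hx hxy.le hy, he, sub_self]
    exact ⟨measurableSet_Ioo, h0, hchord x y hx hxy hy hlen h0⟩
  rcases exists_chord_or_two_short_chords hL huv
    ((continuousOn_primitive_Icc hab hg).mono (Icc_subset_Icc hau hvb)) h with
    ⟨x, hx, hxv, he⟩ | ⟨z, w, huz, hzw, hwv, hz, hw, huw, hFz, hFw⟩
  · refine le_integral_of_balanced hgm hs hr hM
      (hbal x (x + L) (by linarith) (by linarith) (by linarith) (by linarith) he)
      (Ioo_subset_Ioo (by linarith) (by linarith)) ?_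
    rw [Real.volume_real_Ioo_of_le (by linarith)]
    linarith
  · have hsub : Ioo u z ∪ Ioo z w ⊆ Ioo a b :=
      union_subset (Ioo_subset_Ioo hau (by linarith)) (Ioo_subset_Ioo (by linarith) (by linarith))
    have hdis : Disjoint (Ioo u z) (Ioo z w) := by
      rw [Set.disjoint_left]
      intro x h1 h2
      linarith [h1.2, h2.1]
    refine le_integral_of_balanced hgm hs hr hM
      ((hbal u z hau huz (by linarith) hz hFz.symm).union
        (hbal z w (by linarith) hzw (by linarith) hw (hFz.trans hFw.symm)) hdis
        (hg.mono_set hsub) (hg2.mono_set hsub)) hsub ?_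
    rw [measureReal_union hdis measurableSet_Ioo (by simp) (by simp), Real.volume_real_Ioo_of_le huz.le,
      Real.volume_real_Ioo_of_le hzw.le]
    linarith

/-- Up to the last point `e` where the primitive `F` takes the value `F a`, the interval `(a, e)` is
itself a chord. Beyond `e` the rising sun intervals are chords, and off them `F` is never exceeded
to the right, so `g = F' ≤ 0` almost everywhere by Lebesgue differentiation. -/
theorem exists_balanced_nonpos_off (hab : a < b)
    (hgm : AEStronglyMeasurable g (volume.restrict (Ioo a b)))
    (hs : ∀ x, -s ≤ g x) (hr : ∀ x, g x ≤ r)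
    (hchord : ∀ x y, a ≤ x → x < y → y ≤ b → ∫ t in Ioo x y, g t = 0 →
      ∫ t in Ioo x y, (g t ^ 2 - M) ≤ 0) (hle : ∫ t in Ioo a b, g t ≤ 0) :
    ∃ U ⊆ Ioo a b, Balanced g M U ∧ ∀ᵐ x, x ∈ Ioo a b \ U → g x ≤ 0 := by
  have hg := integrableOn_of_bounds hgm hs hr
  have hg2 : IntegrableOn (fun x => g x ^ 2 - M) (Ioo a b) :=
    (integrableOn_sq_of_bounds hgm hs hr).sub (integrableOn_const (by simp))
  set F : ℝ → ℝ := fun x => ∫ t in a..x, g t with hF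
  have hFc : ContinuousOn F (Icc a b) := continuousOn_primitive_Icc hab hg
  have hbal : ∀ x y, a ≤ x → x < y → y ≤ b → F x = F y → Balanced g M (Ioo x y) := by
    intro x y hx hxy hy he
    have h0 : ∫ t in Ioo x y, g t = 0 := by
      rw [integral_Ioo_eq_sub hab hg hx hxy.le hy]
      exact sub_eq_zero.2 he.symm
    exact ⟨measurableSet_Ioo, h0, hchord x y hx hxy hy h0⟩
  have hFb : F b ≤ F a := by
    rw [integral_Ioo_eq_sub hab hg le_rfl hab.le le_rfl] at hle
    exact sub_nonpos.1 hle
  have hcomp : IsCompact (Icc a b ∩ F ⁻¹' {F a}) :=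
    isCompact_Icc.of_isClosed_subset
      (hFc.preimage_isClosed_of_isClosed isClosed_Icc isClosed_singleton) inter_subset_left
  obtain ⟨e, ⟨⟨hae, heb⟩, hFe⟩, hlast⟩ := hcomp.exists_isGreatest ⟨a, ⟨le_rfl, hab.le⟩, rfl⟩
  have hFe : F e = F a := hFe
  -- Since `F b ≤ F a = F e`, a value above `F e` would force a later return to this level.
  have hmax : ∀ x ∈ Icc e b, F x ≤ F e := by
    intro x hx
    by_contra! hlt
    obtain ⟨z, hz, hFz⟩ : F e ∈ F '' Icc x b :=
      intermediate_value_Icc' hx.2 (hFc.mono (Icc_subset_Icc_left (by linarith [hx.1])))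
        ⟨by linarith, hlt.le⟩
    have := hlast ⟨⟨by linarith [hx.1, hz.1], hz.2⟩, hFz.trans hFe⟩
    have hxe : x = e := by linarith [hx.1, hz.1]
    rw [hxe] at hlt
    exact lt_irrefl _ hlt
  obtain ⟨S, hSc, hSd, hSp, hoff⟩ :=
    exists_rising_sun (hFc.mono (Icc_subset_Icc_left hae)) hmax
  have hSsub : ⋃ p ∈ S, Ioo p.1 p.2 ⊆ Ioo e b :=
    iUnion₂_subset fun p hp => Ioo_subset_Ioo (hSp p hp).1 (hSp p hp).2.2.1
  have hsub : Ioo a e ∪ ⋃ p ∈ S, Ioo p.1 p.2 ⊆ Ioo a b :=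
    union_subset (Ioo_subset_Ioo_right heb) (hSsub.trans (Ioo_subset_Ioo_left hae))
  have hdis : Disjoint (Ioo a e) (⋃ p ∈ S, Ioo p.1 p.2) := by
    rw [Set.disjoint_left]
    intro x h1 h2
    linarith [h1.2, (hSsub h2).1]
  refine ⟨_, hsub, Balanced.union ?_ ?_ hdis (hg.mono_set hsub) (hg2.mono_set hsub), ?_⟩
  · rcases hae.eq_or_lt with h | h
    · rw [← h, Ioo_self]; exact .empty g M
    · exact hbal a e le_rfl h heb hFe.symm
  · exact .biUnion hSc hSd
      (fun p hp => hbal _ _ (hae.trans (hSp p hp).1) (hSp p hp).2.1 (hSp p hp).2.2.1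
        (hSp p hp).2.2.2)
      (hg.mono_set (subset_union_right.trans hsub)) (hg2.mono_set (subset_union_right.trans hsub))
  · have hne : ∀ᵐ x : ℝ, x ≠ e := by simp [ae_iff]
    filter_upwards [((intervalIntegrable_iff_integrableOn_Ioo_of_le hab.le).2
      hg).ae_hasDerivAt_integral, hne] with x hx hxe ⟨hxI, hxU⟩
    rw [uIcc_of_le hab.le] at hx
    have hex : e < x := by
      refine lt_of_le_of_ne (le_of_not_gt fun h => hxU (.inl ⟨hxI.1, h⟩)) hxe.symm
    exact HasDerivAt.nonpos_of_forall_right (hx ⟨hxI.1.le, hxI.2.le⟩ a ⟨le_rfl, hab.le⟩) hxI.2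
      (hoff x ⟨hex, hxI.2⟩ fun h => hxU (.inr h))

theorem le_integral_of_integral_nonpos (hab : a < b) (hL : 0 < L) (hr0 : 0 ≤ r) (hM0 : 0 ≤ M)
    (hgm : AEStronglyMeasurable g (volume.restrict (Ioo a b)))
    (hs : ∀ x, -s ≤ g x) (hr : ∀ x, g x ≤ r) (hM : M ≤ r * s)
    (hchord : ∀ x y, a ≤ x → x < y → y ≤ b → y - x ≤ L → ∫ t in Ioo x y, g t = 0 →
      ∫ t in Ioo x y, (g t ^ 2 - M) ≤ 0)
    (hsL : s * L ≤ ∫ t in Ioo a b, (g t + s)) (hle : ∫ t in Ioo a b, g t ≤ 0) :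
    (r * s - M) * L ≤ ∫ x in Ioo a b, (g x + s) * (r - g x) := by
  by_cases hlong : ∃ u v, a ≤ u ∧ v ≤ b ∧ u + L ≤ v ∧ ∫ t in a..u, g t = ∫ t in a..v, g t
  · obtain ⟨u, v, hau, hvb, huv, h⟩ := hlong
    exact le_integral_of_long_chord hab hL hgm hs hr hM hchord hau hvb huv h
  have hg := integrableOn_of_bounds hgm hs hr
  have hg2 := integrableOn_sq_of_bounds hgm hs hr
  have hc : ∀ k : ℝ, IntegrableOn (fun _ => k) (Ioo a b) := fun k => integrableOn_const (by simp)
  obtain ⟨U, hUI, hU, hoff⟩ : ∃ U ⊆ Ioo a b, Balanced g M U ∧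
      ∀ᵐ x, x ∈ Ioo a b \ U → g x ≤ 0 := by
    refine exists_balanced_nonpos_off hab hgm hs hr (fun x y hx hxy hy h0 => ?_) hle
    refine hchord x y hx hxy hy ?_ h0
    -- With no long chord available, every chord satisfies the length restriction of `hchord`.
    by_contra! hlt
    refine hlong ⟨x, y, hx, hy, by linarith, ?_⟩
    rw [integral_Ioo_eq_sub hab hg hx hxy.le hy] at h0
    linarith
  by_cases hUL : L ≤ volume.real U
  · exact le_integral_of_balanced hgm hs hr hM hU hUI hUL
  push Not at hUL
  have hUm : volume U ≠ ⊤ := ((measure_mono hUI).trans_lt (by simp)).ne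
  have hh : IntegrableOn (fun x => (g x + s) * (r - g x)) (Ioo a b) := by
    have : (fun x => (g x + s) * (r - g x)) =
        fun x => (r * s + (r - s) * g x) - g x ^ 2 := by ext x; ring
    rw [this]
    exact ((hc _).add (hg.const_mul _)).sub hg2
  have hgs : IntegrableOn (fun x => g x + s) (Ioo a b) := hg.add (hc s)
  have hsplit := integral_inter_add_sdiff hU.1 hh
  have hsplit' := integral_inter_add_sdiff hU.1 hgs
  rw [inter_eq_self_of_subset_right hUI] at hsplit hsplit'
  have h1 : (r * s - M) * volume.real U ≤ ∫ x in U, (g x + s) * (r - g x) :=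
    hU.le_setIntegral hUm (hg.mono_set hUI) (hg2.mono_set hUI)
  have h2 : ∫ x in U, (g x + s) = volume.real U * s := by
    rw [integral_add (hg.mono_set hUI) ((hc s).mono_set hUI), hU.2, setIntegral_const]
    simp
  -- Off `U`, `g ≤ 0` gives `r - g ≥ r`.
  have h3 : r * ∫ x in Ioo a b \ U, (g x + s) ≤ ∫ x in Ioo a b \ U, (g x + s) * (r - g x) := by
    rw [← integral_const_mul]
    refine setIntegral_mono_on_ae ((hgs.mono_set sdiff_subset).const_mul _)
      (hh.mono_set sdiff_subset) (measurableSet_Ioo.diff hU.1) ?_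
    filter_upwards [hoff] with x hx hxU
    nlinarith [hx hxU, hs x]
  have h4 : r * (s * L - volume.real U * s) ≤ r * ∫ x in Ioo a b \ U, (g x + s) :=
    mul_le_mul_of_nonneg_left (by linarith) hr0
  -- The sum `(r s - M)|U| + r s (L - |U|)` exceeds `(r s - M) L` by `M (L - |U|) ≥ 0`.
  nlinarith

theorem le_integral_mul_of_chords (hab : a < b) (hL : 0 < L) (hr0 : 0 ≤ r) (hs0 : 0 ≤ s)
    (hM0 : 0 ≤ M) (hgm : AEStronglyMeasurable g (volume.restrict (Ioo a b)))
    (hs : ∀ x, -s ≤ g x) (hr : ∀ x, g x ≤ r) (hM : M ≤ r * s)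
    (hchord : ∀ x y, a ≤ x → x < y → y ≤ b → y - x ≤ L → ∫ t in Ioo x y, g t = 0 →
      ∫ t in Ioo x y, (g t ^ 2 - M) ≤ 0)
    (hsL : s * L ≤ ∫ t in Ioo a b, (g t + s)) (hrL : r * L ≤ ∫ t in Ioo a b, (r - g t)) :
    (r * s - M) * L ≤ ∫ x in Ioo a b, (g x + s) * (r - g x) := by
  rcases le_total (∫ t in Ioo a b, g t) 0 with hle | hle
  · exact le_integral_of_integral_nonpos hab hL hr0 hM0 hgm hs hr hM hchord hsL hle
  -- The claim is invariant under `g ↦ -g` with `r` and `s` exchanged.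
  · have := le_integral_of_integral_nonpos (g := fun x => -g x) (r := s) (s := r) hab hL hs0 hM0
      hgm.neg (fun x => by linarith [hr x]) (fun x => by linarith [hs x]) (by linarith)
      (fun x y hx hxy hy hl h0 => by
        rw [integral_neg, neg_eq_zero] at h0
        simpa using hchord x y hx hxy hy hl h0)
      (by simpa [neg_add_eq_sub] using hrL) (by rw [integral_neg]; linarith)
    rw [mul_comm r s]
    refine this.trans_eq (integral_congr_ae (ae_of_all _ fun x => ?_))
    simp only
    ring

end Bounded

/-! ### Equimeasurability of the decreasing rearrangement. -/

section Rearrangement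

variable {a b : ℝ} {φ : ℝ → ℝ}

theorem volume_superlevel (hφ : AEMeasurable φ (volume.restrict (Ioo a b))) (l : ℝ) :
    volume {s | s ∈ Ioo a b ∧ l < φ s} = (volume.restrict (Ioo a b)).map φ (Ioi l) := by
  rw [Measure.map_apply_of_aemeasurable hφ measurableSet_Ioi,
    Measure.restrict_apply₀ (hφ.nullMeasurable measurableSet_Ioi)]
  congr 1
  ext s
  simp [and_comm]

theorem volume_superlevel_le (l : ℝ) :
    volume {s | s ∈ Ioo a b ∧ l < φ s} ≤ ENNReal.ofReal (b - a) := by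
  rw [← Real.volume_Ioo]
  exact measure_mono fun s hs => hs.1

theorem exists_lt_measure_Ioi_of_lt (ν : Measure ℝ) {l : ℝ} {x : ENNReal} (h : x < ν (Ioi l)) :
    ∃ l', l < l' ∧ x < ν (Ioi l') := by
  have hU : ⋃ n : ℕ, Ioi (l + 1 / ((n : ℝ) + 1)) = Ioi l := by
    ext y
    simp only [mem_iUnion, mem_Ioi]
    constructor
    · rintro ⟨n, hn⟩
      have : 0 < 1 / ((n : ℝ) + 1) := by positivity
      linarith
    · intro hy
      obtain ⟨n, hn⟩ := exists_nat_one_div_lt (sub_pos.2 hy)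
      exact ⟨n, by linarith⟩
  have hmono : Monotone fun n : ℕ => Ioi (l + 1 / ((n : ℝ) + 1)) := by
    intro m n hmn
    apply Ioi_subset_Ioi
    have : 1 / ((n : ℝ) + 1) ≤ 1 / ((m : ℝ) + 1) := by gcongr
    linarith
  have ht := tendsto_measure_iUnion_atTop (μ := ν) hmono
  rw [hU] at ht
  obtain ⟨n, hn⟩ := (ht.eventually (lt_mem_nhds h)).exists
  exact ⟨_, by simp; positivity, hn⟩

theorem exists_measure_Ioi_lt (ν : Measure ℝ) [IsFiniteMeasure ν] {x : ENNReal} (h : 0 < x) :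
    ∃ l, ν (Ioi l) < x := by
  have hU : ⋂ n : ℕ, Ioi (n : ℝ) = ∅ := by
    ext y
    simp only [mem_iInter, mem_Ioi, mem_empty_iff_false, iff_false, not_forall, not_lt]
    exact exists_nat_ge y
  have ht := tendsto_measure_iInter_atTop (μ := ν) (s := fun n : ℕ => Ioi (n : ℝ))
    (fun _ => measurableSet_Ioi.nullMeasurableSet)
    (fun m n hmn => Ioi_subset_Ioi (by exact_mod_cast hmn)) ⟨0, measure_ne_top _ _⟩
  rw [hU, measure_empty] at ht
  obtain ⟨n, hn⟩ := (ht.eventually (gt_mem_nhds h)).exists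
  exact ⟨_, hn⟩

theorem exists_lt_measure_Ioi (ν : Measure ℝ) {x : ENNReal} (h : x < ν univ) :
    ∃ l, x < ν (Ioi l) := by
  have hU : ⋃ n : ℕ, Ioi (-(n : ℝ)) = univ := by
    ext y
    simp only [mem_iUnion, mem_Ioi, mem_univ, iff_true]
    obtain ⟨n, hn⟩ := exists_nat_gt (-y)
    exact ⟨n, by linarith⟩
  have ht := tendsto_measure_iUnion_atTop (μ := ν) (s := fun n : ℕ => Ioi (-(n : ℝ)))
    (fun m n hmn => Ioi_subset_Ioi (by simpa using hmn))
  rw [hU] at ht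
  obtain ⟨n, hn⟩ := (ht.eventually (lt_mem_nhds h)).exists
  exact ⟨_, hn⟩

theorem rearr_set_nonempty (hφ : AEMeasurable φ (volume.restrict (Ioo a b))) {t : ℝ} (ht : a < t) :
    {l : ℝ | volume {s | s ∈ Ioo a b ∧ l < φ s} ≤ ENNReal.ofReal (t - a)}.Nonempty := by
  obtain ⟨l, hl⟩ := exists_measure_Ioi_lt ((volume.restrict (Ioo a b)).map φ)
    (x := ENNReal.ofReal (t - a)) (by simpa using ht)
  exact ⟨l, by rw [mem_ofPred_eq, volume_superlevel hφ]; exact hl.le⟩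

theorem rearr_set_bddBelow (hφ : AEMeasurable φ (volume.restrict (Ioo a b))) {t : ℝ} (hta : a < t)
    (ht : t < b) :
    BddBelow {l : ℝ | volume {s | s ∈ Ioo a b ∧ l < φ s} ≤ ENNReal.ofReal (t - a)} := by
  obtain ⟨l, hl⟩ := exists_lt_measure_Ioi ((volume.restrict (Ioo a b)).map φ)
    (x := ENNReal.ofReal (t - a)) (by
      rw [Measure.map_apply_of_aemeasurable hφ .univ]
      simp only [preimage_univ, Measure.restrict_apply_univ, Real.volume_Ioo]
      exact (ENNReal.ofReal_lt_ofReal_iff (by linarith)).2 (by linarith))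
  refine ⟨l, fun l' hl' => ?_⟩
  rw [mem_ofPred_eq, volume_superlevel hφ] at hl'
  by_contra! hlt
  exact absurd ((measure_mono (Ioi_subset_Ioi hlt.le)).trans hl') (not_le.2 hl)

/-- The distribution function is right-continuous: a strict inequality at `l` persists at some `l' >
l`, which keeps the infimum strictly above `l`. -/
theorem lt_rearr_iff (hφ : AEMeasurable φ (volume.restrict (Ioo a b))) {t : ℝ} (ht : t ∈ Ioo a b)
    (l : ℝ) :
    l < rearr a b φ t ↔ ENNReal.ofReal (t - a) < volume {s | s ∈ Ioo a b ∧ l < φ s} := by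
  constructor
  · intro h
    by_contra! hle
    exact absurd (csInf_le (rearr_set_bddBelow hφ ht.1 ht.2) hle) (not_le.2 h)
  · intro h
    rw [volume_superlevel hφ] at h
    obtain ⟨l', hll', hl'⟩ := exists_lt_measure_Ioi_of_lt _ h
    refine hll'.trans_le (le_csInf (rearr_set_nonempty hφ ht.1) fun k hk => ?_)
    rw [mem_ofPred_eq, volume_superlevel hφ] at hk
    by_contra! hlt
    exact absurd ((measure_mono (Ioi_subset_Ioi hlt.le)).trans hk) (not_le.2 hl')

theorem antitoneOn_rearr (hφ : AEMeasurable φ (volume.restrict (Ioo a b))) :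
    AntitoneOn (rearr a b φ) (Ioo a b) := by
  intro t ht u hu htu
  refine csInf_le_csInf (rearr_set_bddBelow hφ hu.1 hu.2) (rearr_set_nonempty hφ ht.1) ?_
  intro l hl
  exact le_trans hl (ENNReal.ofReal_le_ofReal (by linarith))

theorem aemeasurable_rearr (hφ : AEMeasurable φ (volume.restrict (Ioo a b))) :
    AEMeasurable (rearr a b φ) (volume.restrict (Ioo a b)) :=
  aemeasurable_restrict_of_antitoneOn measurableSet_Ioo (antitoneOn_rearr hφ)

theorem volume_superlevel_rearr (hφ : AEMeasurable φ (volume.restrict (Ioo a b))) (l : ℝ) :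
    volume {s | s ∈ Ioo a b ∧ l < rearr a b φ s} = volume {s | s ∈ Ioo a b ∧ l < φ s} := by
  set m := volume {s | s ∈ Ioo a b ∧ l < φ s} with hm
  have hmle : m ≤ ENNReal.ofReal (b - a) := volume_superlevel_le l
  have hmt : m ≠ ⊤ := (hmle.trans_lt ENNReal.ofReal_lt_top).ne
  -- Superlevel sets of the rearrangement are initial intervals of the prescribed measure.
  have hset : {s | s ∈ Ioo a b ∧ l < rearr a b φ s} = Ioo a (a + m.toReal) := by
    ext t
    simp only [mem_ofPred_eq]
    constructor
    · rintro ⟨ht, hl⟩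
      rw [lt_rearr_iff hφ ht, ENNReal.ofReal_lt_iff_lt_toReal (by linarith [ht.1]) hmt] at hl
      exact ⟨ht.1, by linarith⟩
    · rintro ⟨h1, h2⟩
      have hlt : ENNReal.ofReal (t - a) < m :=
        (ENNReal.ofReal_lt_iff_lt_toReal (by linarith) hmt).2 (by linarith)
      have htb : t < b := by
        have := (ENNReal.ofReal_lt_ofReal_iff').1 (hlt.trans_le hmle)
        linarith [this.1]
      exact ⟨⟨h1, htb⟩, (lt_rearr_iff hφ ⟨h1, htb⟩ l).2 hlt⟩
  rw [hset, Real.volume_Ioo, add_sub_cancel_left, ENNReal.ofReal_toReal hmt]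

/-- A function and its decreasing rearrangement are equimeasurable. -/
theorem identDistrib_rearr (hφ : AEMeasurable φ (volume.restrict (Ioo a b))) :
    ProbabilityTheory.IdentDistrib φ (rearr a b φ) (volume.restrict (Ioo a b))
      (volume.restrict (Ioo a b)) := by
  have hψ := aemeasurable_rearr hφ
  refine ⟨hφ, hψ, Measure.ext_of_Iic _ _ fun l => ?_⟩
  have h : (volume.restrict (Ioo a b)).map φ (Ioi l) =
      (volume.restrict (Ioo a b)).map (rearr a b φ) (Ioi l) := by
    rw [← volume_superlevel hφ, ← volume_superlevel hψ, volume_superlevel_rearr hφ]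
  rw [← compl_Ioi, measure_compl measurableSet_Ioi (measure_ne_top _ _),
    measure_compl measurableSet_Ioi (measure_ne_top _ _), h,
    Measure.map_apply_of_aemeasurable hφ .univ, Measure.map_apply_of_aemeasurable hψ .univ]
  simp

theorem memLp_rearr (hφ : MemLp φ 2 (volume.restrict (Ioo a b))) :
    MemLp (rearr a b φ) 2 (volume.restrict (Ioo a b)) :=
  (identDistrib_rearr hφ.1.aemeasurable).memLp_snd hφ

theorem integral_comp_rearr (hφ : AEMeasurable φ (volume.restrict (Ioo a b))) {H : ℝ → ℝ}
    (hH : Measurable H) :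
    ∫ x in Ioo a b, H (rearr a b φ x) = ∫ x in Ioo a b, H (φ x) :=
  (((identDistrib_rearr hφ).comp hH).integral_eq).symm

end Rearrangement

/-! ### Quadratic oscillation and truncation. -/

section Oscillation

variable {a b c d : ℝ} {φ : ℝ → ℝ}

theorem setIntegral_sub_const_sq {U : Set ℝ} (hU : volume U ≠ ⊤) (hφ : IntegrableOn φ U)
    (hφ2 : IntegrableOn (fun x => φ x ^ 2) U) (k : ℝ) :
    ∫ x in U, (φ x - k) ^ 2 =
      (∫ x in U, φ x ^ 2) - 2 * k * (∫ x in U, φ x) + k ^ 2 * volume.real U := by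
  have hc : IntegrableOn (fun _ => k ^ 2) U := integrableOn_const hU
  have e : ∀ x, (φ x - k) ^ 2 = (φ x ^ 2 - 2 * k * φ x) + k ^ 2 := by intro x; ring
  simp_rw [e]
  rw [integral_add (f := fun x => φ x ^ 2 - 2 * k * φ x)
    (Integrable.sub hφ2 (hφ.const_mul (2 * k))) hc,
    integral_sub hφ2 (hφ.const_mul _), integral_const_mul, setIntegral_const]
  simp [mul_comm]

theorem average_Ioo (hcd : c < d) (f : ℝ → ℝ) :
    ⨍ x in Ioo c d, f x = (∫ x in Ioo c d, f x) / (d - c) := by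
  rw [setAverage_eq, Real.volume_real_Ioo_of_le hcd.le, smul_eq_mul, inv_mul_eq_div]

theorem integral_sub_average_sq (hcd : c < d) (hφ : IntegrableOn φ (Ioo c d))
    (hφ2 : IntegrableOn (fun x => φ x ^ 2) (Ioo c d)) :
    ∫ x in Ioo c d, (φ x - ⨍ y in Ioo c d, φ y) ^ 2 = (d - c) * osc φ c d := by
  have h : d - c ≠ 0 := by linarith
  rw [setIntegral_sub_const_sq (by simp) hφ hφ2, osc, average_Ioo hcd, average_Ioo hcd,
    Real.volume_real_Ioo_of_le hcd.le]
  field_simp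
  ring

theorem osc_nonneg (hcd : c < d) (hφ : IntegrableOn φ (Ioo c d))
    (hφ2 : IntegrableOn (fun x => φ x ^ 2) (Ioo c d)) : 0 ≤ osc φ c d := by
  have h := integral_sub_average_sq hcd hφ hφ2
  have h0 : 0 ≤ ∫ x in Ioo c d, (φ x - ⨍ y in Ioo c d, φ y) ^ 2 :=
    integral_nonneg fun x => sq_nonneg _
  rw [h] at h0
  exact nonneg_of_mul_nonneg_right h0 (by linarith)

/-- Truncation of a real number to `[m, w]`. -/
noncomputable def clamp (m w x : ℝ) : ℝ := max m (min w x)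

theorem measurable_clamp (m w : ℝ) : Measurable (clamp m w) :=
  measurable_const.max (measurable_const.min measurable_id)

theorem le_clamp (m w x : ℝ) : m ≤ clamp m w x := le_max_left _ _

theorem clamp_le {m w : ℝ} (h : m ≤ w) (x : ℝ) : clamp m w x ≤ w := max_le h (min_le_left _ _)

theorem clamp_of_mem {m w x : ℝ} (h1 : m ≤ x) (h2 : x ≤ w) : clamp m w x = x := by
  rw [clamp, min_eq_right h2, max_eq_right h1]

theorem sq_clamp_sub_clamp_le (m w x y : ℝ) :
    (clamp m w x - clamp m w y) ^ 2 ≤ (x - y) ^ 2 := by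
  rw [sq_le_sq]
  unfold clamp
  refine (abs_max_sub_max_le_max _ _ _ _).trans ?_
  simp only [sub_self, abs_zero]
  refine max_le (abs_nonneg _) ((abs_min_sub_min_le_max _ _ _ _).trans ?_)
  simp

/-- Truncation does not increase quadratic oscillation. -/
theorem integral_clamp_sub_sq_le {m w k : ℝ} (hmw : m ≤ w) (hcd : c < d)
    (hφ : IntegrableOn φ (Ioo c d)) (hφ2 : IntegrableOn (fun x => φ x ^ 2) (Ioo c d))
    (h0 : ∫ x in Ioo c d, (clamp m w (φ x) - k) = 0) :
    ∫ x in Ioo c d, (clamp m w (φ x) - k) ^ 2 ≤ (d - c) * osc φ c d := by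
  set β := ⨍ y in Ioo c d, φ y with hβ
  have hm : AEStronglyMeasurable (fun x => clamp m w (φ x) - k) (volume.restrict (Ioo c d)) :=
    (((measurable_clamp m w).comp_aemeasurable hφ.1.aemeasurable).sub_const k).aestronglyMeasurable
  have hs : ∀ x, -(k - m) ≤ clamp m w (φ x) - k := fun x => by linarith [le_clamp m w (φ x)]
  have hr : ∀ x, clamp m w (φ x) - k ≤ w - k := fun x => by linarith [clamp_le hmw (φ x)]
  have hg := integrableOn_of_bounds hm hs hr
  have hg2 := integrableOn_sq_of_bounds hm hs hr
  have hc : ∀ k : ℝ, IntegrableOn (fun _ => k) (Ioo c d) := fun k => integrableOn_const (by simp)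
  rw [← integral_sub_average_sq hcd hφ hφ2]
  -- The mean-zero function is closest in `L²` to the constant `0`; comparing with the truncated
  -- mean of `φ` lets the 1-Lipschitz bound for `clamp` apply pointwise.
  have h1 := setIntegral_sub_const_sq (by simp) hg hg2 (clamp m w β - k)
  rw [h0] at h1
  have h2 : ∫ x in Ioo c d, (clamp m w (φ x) - k - (clamp m w β - k)) ^ 2 ≤
      ∫ x in Ioo c d, (φ x - β) ^ 2 := by
    refine integral_mono_of_nonneg (ae_of_all _ fun x => sq_nonneg _) ?_
      (ae_of_all _ fun x => ?_)
    · have : (fun x => (φ x - β) ^ 2) = fun x => (φ x ^ 2 - 2 * β * φ x) + β ^ 2 := by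
        ext x; ring
      rw [this]
      exact (hφ2.sub (hφ.const_mul _)).add (hc _)
    · simp only [sub_sub_sub_cancel_right]
      exact sq_clamp_sub_clamp_le _ _ _ _
  have h3 : 0 ≤ (clamp m w β - k) ^ 2 * volume.real (Ioo c d) := by positivity
  linarith

end Oscillation

/-! ### The oscillation estimate for the rearrangement. -/

section Core

variable {a b c d M : ℝ} {φ : ℝ → ℝ}

theorem osc_rearr_le_of_interior (hac : a < c) (hcd : c < d) (hdb : d < b)
    (hφ : MemLp φ 2 (volume.restrict (Ioo a b)))
    (hosc : ∀ x y, a ≤ x → x < y → y ≤ b → y - x ≤ d - c → osc φ x y ≤ M) :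
    osc (rearr a b φ) c d ≤ M := by
  have hab : a < b := by linarith
  have hL : 0 < d - c := by linarith
  have hφm : AEMeasurable φ (volume.restrict (Ioo a b)) := hφ.1.aemeasurable
  have hφ1 : IntegrableOn φ (Ioo a b) := hφ.integrable one_le_two
  have hφ2 : IntegrableOn (fun x => φ x ^ 2) (Ioo a b) := hφ.integrable_sq
  set ψ := rearr a b φ with hψ
  have hψL : MemLp ψ 2 (volume.restrict (Ioo a b)) := memLp_rearr hφ
  have hJI : Ioo c d ⊆ Ioo a b := Ioo_subset_Ioo hac.le hdb.le
  have hψ1 : IntegrableOn ψ (Ioo c d) :=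
    IntegrableOn.mono_set (hψL.integrable one_le_two : IntegrableOn ψ (Ioo a b) volume) hJI
  have hψ2 : IntegrableOn (fun x => ψ x ^ 2) (Ioo c d) :=
    IntegrableOn.mono_set (hψL.integrable_sq :
      IntegrableOn (fun x => ψ x ^ 2) (Ioo a b) volume) hJI
  have hanti : AntitoneOn ψ (Ioo a b) := antitoneOn_rearr hφm
  have hM0 : 0 ≤ M :=
    (osc_nonneg hcd (hφ1.mono_set hJI) (hφ2.mono_set hJI)).trans
      (hosc c d hac.le hcd hdb.le le_rfl)
  have hcI : c ∈ Ioo a b := ⟨hac, by linarith⟩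
  have hdI : d ∈ Ioo a b := ⟨by linarith, hdb⟩
  set w := ψ c with hw
  set m := ψ d with hm
  have hmw : m ≤ w := hanti hcI hdI hcd.le
  have hmψ : ∀ x ∈ Ioo c d, m ≤ ψ x := fun x hx => hanti (hJI hx) hdI hx.2.le
  have hψw : ∀ x ∈ Ioo c d, ψ x ≤ w := fun x hx => hanti hcI (hJI hx) hx.1.le
  have hclψ : ∀ x ∈ Ioo c d, clamp m w (ψ x) = ψ x :=
    fun x hx => clamp_of_mem (hmψ x hx) (hψw x hx)
  have hc : ∀ k x y : ℝ, IntegrableOn (fun _ => k) (Ioo x y) :=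
    fun k x y => integrableOn_const (by simp)
  set α := ⨍ x in Ioo c d, ψ x with hα
  have hαint : ∫ x in Ioo c d, ψ x = α * (d - c) := by
    rw [hα, average_Ioo hcd]; field_simp
  have hsub : ∀ k, ∫ x in Ioo c d, (ψ x - k) = (α - k) * (d - c) := by
    intro k
    rw [integral_sub hψ1 (hc k c d), hαint, setIntegral_const, Real.volume_real_Ioo_of_le hcd.le,
      smul_eq_mul]
    ring
  have hsub' : ∀ k, ∫ x in Ioo c d, (k - ψ x) = (k - α) * (d - c) := by
    intro k
    rw [integral_sub (hc k c d) hψ1, hαint, setIntegral_const, Real.volume_real_Ioo_of_le hcd.le,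
      smul_eq_mul]
    ring
  have hs0 : 0 ≤ α - m := by
    have : 0 ≤ ∫ x in Ioo c d, (ψ x - m) :=
      setIntegral_nonneg measurableSet_Ioo fun x hx => by linarith [hmψ x hx]
    rw [hsub] at this
    exact nonneg_of_mul_nonneg_left this hL
  have hr0 : 0 ≤ w - α := by
    have : 0 ≤ ∫ x in Ioo c d, (w - ψ x) :=
      setIntegral_nonneg measurableSet_Ioo fun x hx => by linarith [hψw x hx]
    rw [hsub'] at this
    exact nonneg_of_mul_nonneg_left this hL
  -- Integrate `(ψ - m)(w - ψ) = r s + (r - s)(ψ - α) - (ψ - α)²` over `J`, where `ψ - α` has mean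
  -- zero.
  have hvar : (d - c) * osc ψ c d =
      (w - α) * (α - m) * (d - c) - ∫ x in Ioo c d, (ψ x - m) * (w - ψ x) := by
    have e : ∀ x, (ψ x - m) * (w - ψ x) =
        ((w - α) * (α - m) + ((w - α) - (α - m)) * (ψ x - α)) - (ψ x - α) ^ 2 := by
      intro x; ring
    have hsq : IntegrableOn (fun x => (ψ x - α) ^ 2) (Ioo c d) := by
      have : (fun x => (ψ x - α) ^ 2) = fun x => (ψ x ^ 2 - 2 * α * ψ x) + α ^ 2 := by
        ext x; ring
      rw [this]
      exact (hψ2.sub (hψ1.const_mul _)).add (hc _ _ _)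
    have h1 : IntegrableOn (fun x => ψ x - α) (Ioo c d) := hψ1.sub (hc _ _ _)
    rw [← integral_sub_average_sq hcd hψ1 hψ2]
    simp_rw [e]
    rw [integral_sub (f := fun x => (w - α) * (α - m) + ((w - α) - (α - m)) * (ψ x - α))
      (Integrable.add (hc _ _ _) (h1.const_mul _)) hsq,
      integral_add (hc _ _ _) (h1.const_mul _), integral_const_mul (w - α - (α - m)), hsub, setIntegral_const,
      Real.volume_real_Ioo_of_le hcd.le, smul_eq_mul, ← hα]
    ring
  by_cases hMrs : (w - α) * (α - m) ≤ M
  · have h0 : 0 ≤ ∫ x in Ioo c d, (ψ x - m) * (w - ψ x) :=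
      setIntegral_nonneg measurableSet_Ioo fun x hx =>
        mul_nonneg (by linarith [hmψ x hx]) (by linarith [hψw x hx])
    have h1 : (d - c) * osc ψ c d ≤ (d - c) * M := by
      rw [hvar]
      nlinarith
    exact le_of_mul_le_mul_left h1 hL
  push Not at hMrs
  have hclm := measurable_clamp m w
  have hgm : AEStronglyMeasurable (fun x => clamp m w (φ x) - α) (volume.restrict (Ioo a b)) :=
    ((hclm.comp_aemeasurable hφm).sub_const α).aestronglyMeasurable
  have hclψm : AEStronglyMeasurable (fun x => clamp m w (ψ x)) (volume.restrict (Ioo a b)) :=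
    (hclm.comp_aemeasurable hψL.1.aemeasurable).aestronglyMeasurable
  have hclI : IntegrableOn (fun x => clamp m w (ψ x)) (Ioo a b) :=
    integrableOn_of_bounds (s := -m) (r := w) hclψm
      (fun x => by linarith [le_clamp m w (ψ x)]) (fun x => clamp_le hmw _)
  have htransfer : ∫ x in Ioo c d, (ψ x - m) * (w - ψ x) =
      ∫ x in Ioo a b, (clamp m w (φ x) - α + (α - m)) * (w - α - (clamp m w (φ x) - α)) := by
    have e1 : ∫ x in Ioo a b, (clamp m w (ψ x) - m) * (w - clamp m w (ψ x)) =
        ∫ x in Ioo a b, (clamp m w (φ x) - m) * (w - clamp m w (φ x)) :=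
      integral_comp_rearr hφm (H := fun y => (clamp m w y - m) * (w - clamp m w y))
        ((hclm.sub_const m).mul (measurable_const.sub hclm))
    have e2 : ∫ x in Ioo a b, (clamp m w (ψ x) - m) * (w - clamp m w (ψ x)) =
        ∫ x in Ioo c d, (clamp m w (ψ x) - m) * (w - clamp m w (ψ x)) := by
      -- By monotonicity the truncation of `ψ` equals `w` to the left of `J` and `m` to its right,
      -- so one factor vanishes.
      refine setIntegral_eq_of_subset_of_forall_sdiff_eq_zero measurableSet_Ioo hJI ?_
      rintro x ⟨hx, hxJ⟩
      rcases le_or_gt x c with h | h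
      · have : w ≤ ψ x := hanti hx hcI h
        rw [clamp, min_eq_left this, max_eq_right hmw, sub_self, mul_zero]
      · have hdx : d ≤ x := by
          by_contra! h'
          exact hxJ ⟨h, h'⟩
        have : ψ x ≤ m := hanti hdI hx hdx
        rw [clamp, max_eq_left ((min_le_right _ _).trans this), sub_self, zero_mul]
    have e3 : ∫ x in Ioo c d, (clamp m w (ψ x) - m) * (w - clamp m w (ψ x)) =
        ∫ x in Ioo c d, (ψ x - m) * (w - ψ x) :=
      setIntegral_congr_fun measurableSet_Ioo fun x hx => by simp only [hclψ x hx]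
    rw [← e3, ← e2, e1]
    congr 1
    ext x
    ring
  have key : ((w - α) * (α - m) - M) * (d - c) ≤
      ∫ x in Ioo a b, (clamp m w (φ x) - α + (α - m)) * (w - α - (clamp m w (φ x) - α)) := by
    refine le_integral_mul_of_chords hab hL hr0 hs0 hM0 hgm
      (fun x => by linarith [le_clamp m w (φ x)]) (fun x => by linarith [clamp_le hmw (φ x)])
      hMrs.le ?_ ?_ ?_
    · intro x y hx hxy hy hlen h0
      have hsubI : Ioo x y ⊆ Ioo a b := Ioo_subset_Ioo hx hy
      have hg2 : IntegrableOn (fun x => (clamp m w (φ x) - α) ^ 2) (Ioo x y) :=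
        IntegrableOn.mono_set (integrableOn_sq_of_bounds (s := α - m) (r := w - α) hgm
          (fun x => by linarith [le_clamp m w (φ x)])
          (fun x => by linarith [clamp_le hmw (φ x)])) hsubI
      rw [integral_sub hg2 (hc _ _ _), setIntegral_const, Real.volume_real_Ioo_of_le hxy.le,
        smul_eq_mul]
      have h1 := integral_clamp_sub_sq_le hmw hxy (hφ1.mono_set hsubI) (hφ2.mono_set hsubI) h0
      have h2 := mul_le_mul_of_nonneg_left (hosc x y hx hxy hy hlen) (by linarith : 0 ≤ y - x)
      linarith
    -- The integral over `J` alone is already `s L`, and the integrand is nonnegative elsewhere; the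
    -- bound with `r` is symmetric.
    · have e1 : ∫ x in Ioo a b, (clamp m w (ψ x) - m) =
          ∫ x in Ioo a b, (clamp m w (φ x) - m) :=
        integral_comp_rearr hφm (H := fun y => clamp m w y - m) (hclm.sub_const m)
      have e2 : ∫ x in Ioo c d, (clamp m w (ψ x) - m) ≤ ∫ x in Ioo a b, (clamp m w (ψ x) - m) :=
        setIntegral_mono_set (hclI.sub (hc _ _ _))
          (ae_of_all _ fun x => by
            simpa using le_clamp m w (ψ x)) hJI.eventuallyLE
      have e3 : ∫ x in Ioo c d, (clamp m w (ψ x) - m) = ∫ x in Ioo c d, (ψ x - m) :=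
        setIntegral_congr_fun measurableSet_Ioo fun x hx => by simp only [hclψ x hx]
      rw [e3, hsub, e1] at e2
      simpa using e2
    · have e1 : ∫ x in Ioo a b, (w - clamp m w (ψ x)) =
          ∫ x in Ioo a b, (w - clamp m w (φ x)) :=
        integral_comp_rearr hφm (H := fun y => w - clamp m w y) (measurable_const.sub hclm)
      have e2 : ∫ x in Ioo c d, (w - clamp m w (ψ x)) ≤ ∫ x in Ioo a b, (w - clamp m w (ψ x)) :=
        setIntegral_mono_set (Integrable.sub (hc w a b) hclI)
          (ae_of_all _ fun x => by
            simpa using clamp_le hmw (ψ x)) hJI.eventuallyLE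
      have e3 : ∫ x in Ioo c d, (w - clamp m w (ψ x)) = ∫ x in Ioo c d, (w - ψ x) :=
        setIntegral_congr_fun measurableSet_Ioo fun x hx => by simp only [hclψ x hx]
      rw [e3, hsub', e1] at e2
      simpa using e2
  rw [← htransfer] at key
  have h1 : (d - c) * osc ψ c d ≤ (d - c) * M := by
    rw [hvar]
    linarith
  exact le_of_mul_le_mul_left h1 hL

/-! ### Intervals reaching the endpoints of `I`. -/

theorem tendsto_integral_shrink {f : ℝ → ℝ} (hcd : c < d) (hf : IntegrableOn f (Ioo c d)) :
    Tendsto (fun ε => ∫ x in Ioo (c + ε) (d - ε), f x) (𝓝[>] 0) (𝓝 (∫ x in Ioo c d, f x)) := by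
  have hF : ContinuousOn (fun x => ∫ t in c..x, f t) (Icc c d) := continuousOn_primitive_Icc hcd hf
  have hev : ∀ᶠ ε : ℝ in 𝓝[>] 0, ε ∈ Ioo 0 ((d - c) / 2) := Ioo_mem_nhdsGT (by linarith)
  have hid : Tendsto (fun ε : ℝ => ε) (𝓝[>] 0) (𝓝 0) := tendsto_nhdsWithin_of_tendsto_nhds tendsto_id
  have h1 : Tendsto (fun ε : ℝ => ∫ t in c..(d - ε), f t) (𝓝[>] 0) (𝓝 (∫ t in c..d, f t)) := by
    refine (hF d ⟨hcd.le, le_rfl⟩).tendsto.comp (tendsto_nhdsWithin_iff.2 ⟨?_, ?_⟩)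
    · simpa using hid.const_sub d
    · filter_upwards [hev] with ε hε
      exact ⟨by linarith [hε.2], by linarith [hε.1]⟩
  have h2 : Tendsto (fun ε : ℝ => ∫ t in c..(c + ε), f t) (𝓝[>] 0) (𝓝 (∫ t in c..c, f t)) := by
    refine (hF c ⟨le_rfl, hcd.le⟩).tendsto.comp (tendsto_nhdsWithin_iff.2 ⟨?_, ?_⟩)
    · simpa using hid.const_add c
    · filter_upwards [hev] with ε hε
      exact ⟨by linarith [hε.1], by linarith [hε.2]⟩
  rw [integral_Ioo_eq_sub hcd hf le_rfl hcd.le le_rfl]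
  refine (h1.sub h2).congr' ?_
  filter_upwards [hev] with ε hε
  rw [integral_Ioo_eq_sub hcd hf (by linarith [hε.1]) (by linarith [hε.2]) (by linarith [hε.1])]

theorem tendsto_osc_shrink (hcd : c < d) (hφ : IntegrableOn φ (Ioo c d))
    (hφ2 : IntegrableOn (fun x => φ x ^ 2) (Ioo c d)) :
    Tendsto (fun ε => osc φ (c + ε) (d - ε)) (𝓝[>] 0) (𝓝 (osc φ c d)) := by
  have hid : Tendsto (fun ε : ℝ => ε) (𝓝[>] 0) (𝓝 0) := tendsto_nhdsWithin_of_tendsto_nhds tendsto_id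
  have hlen : Tendsto (fun ε : ℝ => (d - ε) - (c + ε)) (𝓝[>] 0) (𝓝 (d - c)) := by
    simpa using (hid.const_sub d).sub (hid.const_add c)
  have hne : d - c ≠ 0 := by linarith
  have h := ((tendsto_integral_shrink hcd hφ2).div hlen hne).sub
    (((tendsto_integral_shrink hcd hφ).div hlen hne).pow 2)
  rw [osc, average_Ioo hcd, average_Ioo hcd]
  refine h.congr' ?_
  have hev : ∀ᶠ ε : ℝ in 𝓝[>] 0, ε ∈ Ioo 0 ((d - c) / 2) := Ioo_mem_nhdsGT (by linarith)
  filter_upwards [hev] with ε hε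
  have hlt : c + ε < d - ε := by linarith [hε.2]
  rw [osc, average_Ioo hlt, average_Ioo hlt]
  rfl

/-- If the oscillations of `φ` over the intervals of length at most `d - c` are bounded by `M`,
then so is the oscillation of its decreasing rearrangement over `(c, d)`. -/
theorem osc_rearr_le (hac : a ≤ c) (hcd : c < d) (hdb : d ≤ b)
    (hφ : MemLp φ 2 (volume.restrict (Ioo a b)))
    (hosc : ∀ x y, a ≤ x → x < y → y ≤ b → y - x ≤ d - c → osc φ x y ≤ M) :
    osc (rearr a b φ) c d ≤ M := by
  have hψL : MemLp (rearr a b φ) 2 (volume.restrict (Ioo a b)) := memLp_rearr hφ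
  have hJI : Ioo c d ⊆ Ioo a b := Ioo_subset_Ioo hac hdb
  -- The values of the rearrangement at `a` and `b` carry no usable information, so `J` is exhausted
  -- from inside. The smaller intervals need the hypothesis only for smaller lengths.
  refine le_of_tendsto (tendsto_osc_shrink hcd
    (IntegrableOn.mono_set (hψL.integrable one_le_two) hJI)
    (IntegrableOn.mono_set (hψL.integrable_sq) hJI)) ?_
  have hev : ∀ᶠ ε : ℝ in 𝓝[>] 0, ε ∈ Ioo 0 ((d - c) / 2) := Ioo_mem_nhdsGT (by linarith)
  filter_upwards [hev] with ε hε
  exact osc_rearr_le_of_interior (by linarith [hε.1]) (by linarith [hε.2]) (by linarith [hε.1]) hφ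
    fun x y hx hxy hy hl => hosc x y hx hxy hy (by linarith [hε.1])

/-! ### Consequences for the seminorm, `VMO` and the associated modulus. -/

theorem bounds_subset_bounds_rearr {ξ : ℝ → ℝ} (hξ : IsModulus (b - a) ξ)
    (hφ : MemLp φ 2 (volume.restrict (Ioo a b))) :
    bounds a b ξ φ ⊆ bounds a b ξ (rearr a b φ) := by
  rintro C ⟨hC, hb⟩
  refine ⟨hC, fun c d hac hcd hdb => osc_rearr_le hac hcd hdb hφ fun x y hx hxy hy hl => ?_⟩
  refine (hb x y hx hxy hy).trans (mul_le_mul_of_nonneg_left ?_ (sq_nonneg C))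
  have hmem : ∀ z, 0 ≤ z → z ≤ d - c → z ∈ Icc 0 (b - a) :=
    fun z h1 h2 => ⟨h1, by linarith⟩
  have h0 : 0 ≤ ξ (y - x) := by
    rw [← hξ.map_zero]
    exact hξ.monotoneOn (hmem 0 le_rfl (by linarith)) (hmem _ (by linarith) hl) (by linarith)
  exact pow_le_pow_left₀ h0
    (hξ.monotoneOn (hmem _ (by linarith) hl) (hmem _ (by linarith) le_rfl) hl) 2

/-- Needed because a real `sSup` is a true supremum only for bounded sets. Short intervals are
controlled by vanishing oscillation, those longer than `δ` by `∫ φ² / δ`. -/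
theorem MemVMO.bddAbove_osc (h : MemVMO a b φ) (t : ℝ) :
    BddAbove {y | ∃ c d : ℝ, a ≤ c ∧ c < d ∧ d ≤ b ∧ d - c ≤ t ∧ y = Real.sqrt (osc φ c d)} := by
  obtain ⟨δ, hδ, hv⟩ := h.vanishing 1 one_pos
  have hφ2 : IntegrableOn (fun x => φ x ^ 2) (Ioo a b) := h.memLp.integrable_sq
  refine ⟨Real.sqrt (max 1 ((∫ x in Ioo a b, φ x ^ 2) / δ)), ?_⟩
  rintro y ⟨c, d, hac, hcd, hdb, -, rfl⟩
  refine Real.sqrt_le_sqrt ?_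
  rcases le_or_gt (d - c) δ with hle | hlt
  · exact (hv c d hac hcd hdb hle).trans (le_max_left _ _)
  · refine le_trans ?_ (le_max_right _ _)
    rw [osc, average_Ioo hcd]
    have hmono : ∫ x in Ioo c d, φ x ^ 2 ≤ ∫ x in Ioo a b, φ x ^ 2 :=
      setIntegral_mono_set hφ2 (ae_of_all _ fun x => sq_nonneg _)
        (Ioo_subset_Ioo hac hdb).eventuallyLE
    have h0 : 0 ≤ ∫ x in Ioo a b, φ x ^ 2 := integral_nonneg fun x => sq_nonneg _
    have : (∫ x in Ioo c d, φ x ^ 2) / (d - c) ≤ (∫ x in Ioo a b, φ x ^ 2) / δ :=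
      div_le_div₀ h0 hmono hδ hlt.le
    linarith [sq_nonneg (⨍ x in Ioo c d, φ x)]

theorem MemVMO.rearr (h : MemVMO a b φ) : MemVMO a b (rearr a b φ) := by
  refine ⟨memLp_rearr h.memLp, fun ε hε => ?_⟩
  obtain ⟨δ, hδ, hv⟩ := h.vanishing ε hε
  exact ⟨δ, hδ, fun c d hac hcd hdb hl => osc_rearr_le hac hcd hdb h.memLp
    fun x y hx hxy hy hl' => hv x y hx hxy hy (hl'.trans hl)⟩

theorem MemVMO.assocModulus_rearr_le (h : MemVMO a b φ) (t : ℝ) :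
    assocModulus a b (Campanato.rearr a b φ) t ≤ assocModulus a b φ t := by
  unfold assocModulus
  split_ifs with ht
  · exact le_rfl
  set σ := sSup {y | ∃ c d : ℝ, a ≤ c ∧ c < d ∧ d ≤ b ∧ d - c ≤ t ∧ y = Real.sqrt (osc φ c d)}
    with hσ
  have hσ0 : 0 ≤ σ := by
    refine Real.sSup_nonneg ?_
    rintro y ⟨c, d, -, -, -, -, rfl⟩
    exact Real.sqrt_nonneg _
  refine Real.sSup_le ?_ hσ0
  rintro y ⟨c, d, hac, hcd, hdb, hl, rfl⟩
  refine Real.sqrt_le_iff.2 ⟨hσ0, osc_rearr_le hac hcd hdb h.memLp fun x y hx hxy hy hl' => ?_⟩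
  exact (Real.sqrt_le_left hσ0).1
    (le_csSup (h.bddAbove_osc t) ⟨x, y, hx, hxy, hy, hl'.trans hl, rfl⟩)

end Core
end Campanato

theorem theorem1p2 (a b : ℝ) (hab : a < b) :
    (∀ ξ φ : ℝ → ℝ, Campanato.IsModulus (b - a) ξ → Campanato.MemClass a b ξ φ →
      Campanato.MemClass a b ξ (Campanato.rearr a b φ) ∧
      Campanato.classNorm a b ξ (Campanato.rearr a b φ) ≤ Campanato.classNorm a b ξ φ) ∧
    (∀ φ : ℝ → ℝ, Campanato.MemVMO a b φ →
      Campanato.MemVMO a b (Campanato.rearr a b φ) ∧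
      ∀ t ∈ Set.Icc 0 (b - a),
        Campanato.assocModulus a b (Campanato.rearr a b φ) t ≤ Campanato.assocModulus a b φ t) := by
  refine ⟨fun ξ φ hξ hφ => ?_, fun φ hφ => ⟨hφ.rearr, fun t _ => hφ.assocModulus_rearr_le t⟩⟩
  have hsub := Campanato.bounds_subset_bounds_rearr hξ hφ.memLp
  exact ⟨⟨Campanato.memLp_rearr hφ.memLp, hφ.nonempty_bounds.mono hsub⟩,
    csInf_le_csInf ⟨0, fun C hC => hC.1.le⟩ hφ.nonempty_bounds hsub⟩
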